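/- Let $G$ be a group and let $B,N\le G$ be subgroups. Put $T:=B\cap N$. The pair $(B,N)$ is a \emph{BN-pair} for $G$ if $G=\langle B,N\rangle$, $T\trianglelefteq N$, and the Weyl group $W:=N/T$ has a generating set $S$ of elements of order $2$ such that $sBw\subseteq BwB\cup BswB$ and $sBs^{-1}\not\subseteq B$ for all $s\in S$, $w\in W$. It is \emph{spherical} if $W$ is finite. It is \emph{split} if $T=\bigcap_{w\in W}wBw^{-1}$ and $B=U\rtimes T$ (internal semidirect product) for some nilpotent normal subgroup $U\trianglelefteq B$. The associated building is the set of all left cosets $gP_J$ with $g\in G$, $J\subseteq S$, where $P_J:=B\langle J\rangle B$, ordered by reverse inclusion; its chambers are the cosets $gB$. \textbf{Theorem.} Let $G$ be a compact Hausdorff topological group possessing a split spherical BN-pair $(B,N)$, where $B$ and $N$ are not assumed to be closed in $G$. Then the associated building is finite; in other words, $[G:B]<\infty$. -/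

import Mathlib

open scoped Pointwise

/-- A BN-pair (Tits system) `(B, N)` in a group `G`, together with its set `S` of distinguished
generators of the Weyl group `W = N / (B ∩ N)`. The subgroups are abstract: no topology is
involved. -/
structure BNPair (G : Type*) [Group G] where
  /-- The subgroup `B`. -/
  B : Subgroup G
  /-- The subgroup `N`. -/
  N : Subgroup G
  /-- `G` is generated by `B` and `N`. -/
  sup_eq_top : B ⊔ N = ⊤
  /-- `B ∩ N` is normal in `N`. -/
  [normal : ((B ⊓ N).subgroupOf N).Normal]
  /-- The distinguished generators of the Weyl group. -/
  S : Set (N ⧸ (B ⊓ N).subgroupOf N)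
  closure_S : Subgroup.closure S = ⊤
  orderOf_S : ∀ s ∈ S, orderOf s = 2
  /-- `s B w ⊆ B w B ∪ B s w B` for `s ∈ S` and `w ∈ W`, written with representatives in `N`. -/
  mul_subset : ∀ s w : N, (s : N ⧸ (B ⊓ N).subgroupOf N) ∈ S → ∀ b ∈ B,
    (s : G) * b * w ∈
      DoubleCoset.doubleCoset (w : G) B B ∪ DoubleCoset.doubleCoset ((s : G) * w) B B
  /-- `s B s⁻¹ ⊄ B` for `s ∈ S`. -/
  conj_not_le : ∀ s : N, (s : N ⧸ (B ⊓ N).subgroupOf N) ∈ S →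
    ¬ MulAut.conj (s : G) • B ≤ B

namespace BNPair

variable {G : Type*} [Group G] (P : BNPair G)

/-- The subgroup `T = B ∩ N`. -/
abbrev T : Subgroup G := P.B ⊓ P.N

/-- The Weyl group `W = N / T`. -/
abbrev W : Type _ := P.N ⧸ P.T.subgroupOf P.N

instance : (P.T.subgroupOf P.N).Normal := P.normal

/-- The BN-pair is spherical if its Weyl group is finite. -/
def IsSpherical : Prop := Finite P.W

/-- The BN-pair is saturated if `T` is the intersection of the conjugates `w B w⁻¹`, `w ∈ W`.
Such a conjugate does not depend on the representative of `w` in `N`, as `T ≤ B`. -/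
def IsSaturated : Prop := P.T = ⨅ n : P.N, MulAut.conj (n : G) • P.B

/-- The BN-pair is split if it is saturated and `B = U ⋊ T` for some nilpotent normal subgroup `U`
of `B`. -/
def IsSplit : Prop :=
  P.IsSaturated ∧ ∃ U : Subgroup G, U ≤ P.B ∧ (U.subgroupOf P.B).Normal ∧ Group.IsNilpotent U ∧
    Subgroup.IsComplement' (U.subgroupOf P.B) (P.T.subgroupOf P.B)

/-- The standard parabolic subgroup of type `J ⊆ S`: the subgroup generated by `B` and all
representatives in `N` of elements of `W_J = ⟨J⟩` (as a set, this is `B W_J B`). -/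
def parabolic (J : Set P.W) : Subgroup G :=
  P.B ⊔ ((Subgroup.closure J).comap (QuotientGroup.mk' (P.T.subgroupOf P.N))).map P.N.subtype

/-- The building of the BN-pair: its simplices are the left cosets `g P_J` of the standard
parabolic subgroups, `J ⊆ S`, and the face relation is reverse inclusion. The chambers are the
cosets of `P_∅ = B`. -/
def building : Set (Set G)ᵒᵈ :=
  {A | ∃ J ⊆ P.S, ∃ g : G, A = OrderDual.toDual (g • (P.parabolic J : Set G))}

end BNPair

namespace BNPair

variable {G : Type*} [Group G] (P : BNPair G)

/-! Everything reduces to `B` being closed. Then `B` is compact, so the finitely many Bruhat cells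
are compact; the complement of `B` is a union of such cells, so `B` is open, hence of finite index
in the compact group `G`. Closedness rests on an algebraic criterion, `mem_of_conj_mem_of_eq_mul`:
`g U g⁻¹ ⊆ B` forces `g ∈ B`. Nilpotency of `U` allows climbing its lower central series with this
criterion, which gives `closure U ⊆ B`; one more application gives `closure B ⊆ B`. -/

theorem mul_self_of_mem_S {s : P.W} (hs : s ∈ P.S) : s * s = 1 := by
  have h := pow_orderOf_eq_one s
  rwa [P.orderOf_S s hs, pow_two] at h

theorem inv_eq_of_mem_S {s : P.W} (hs : s ∈ P.S) : s⁻¹ = s :=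
  inv_eq_of_mul_eq_one_left (P.mul_self_of_mem_S hs)

theorem ne_one_of_mem_S {s : P.W} (hs : s ∈ P.S) : s ≠ 1 := by
  rintro rfl
  have h := P.orderOf_S 1 hs
  simp at h

theorem mk_eq_one_iff {n : P.N} : (n : P.W) = 1 ↔ (n : G) ∈ P.B := by
  rw [QuotientGroup.eq_one_iff, Subgroup.mem_subgroupOf, Subgroup.mem_inf]
  exact ⟨fun h => h.1, fun h => ⟨h, n.2⟩⟩

theorem mk_eq_mk_iff {n m : P.N} : (n : P.W) = m ↔ (n : G)⁻¹ * m ∈ P.B := by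
  rw [← inv_mul_eq_one]
  exact P.mk_eq_one_iff (n := n⁻¹ * m)

/-! ### Word length in the Weyl group -/

theorem exists_word (w : P.W) : ∃ l : List P.W, (∀ x ∈ l, x ∈ P.S) ∧ l.prod = w := by
  have hw : w ∈ Subgroup.closure P.S := by rw [P.closure_S]; trivial
  rw [← Subgroup.mem_toSubmonoid, Subgroup.closure_toSubmonoid] at hw
  obtain ⟨l, hl, rfl⟩ := Submonoid.exists_list_of_mem_closure hw
  refine ⟨l, fun x hx => (hl x hx).elim id fun h => ?_, rfl⟩
  have := P.inv_eq_of_mem_S h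
  rw [inv_inv] at this
  rwa [this]

/-- The length of `w` with respect to the generating set `S`. -/
noncomputable def length (w : P.W) : ℕ :=
  sInf {k | ∃ l : List P.W, (∀ x ∈ l, x ∈ P.S) ∧ l.prod = w ∧ l.length = k}

theorem length_prod_le {l : List P.W} (hl : ∀ x ∈ l, x ∈ P.S) : P.length l.prod ≤ l.length :=
  Nat.sInf_le ⟨l, hl, rfl, rfl⟩

theorem exists_reduced_word (w : P.W) :
    ∃ l : List P.W, (∀ x ∈ l, x ∈ P.S) ∧ l.prod = w ∧ l.length = P.length w :=
  Nat.sInf_mem (s := {k | ∃ l : List P.W, (∀ x ∈ l, x ∈ P.S) ∧ l.prod = w ∧ l.length = k})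
    (let ⟨l, hl, h⟩ := P.exists_word w; ⟨l.length, l, hl, h, rfl⟩)

theorem length_mul_le {s : P.W} (hs : s ∈ P.S) (w : P.W) :
    P.length (s * w) ≤ P.length w + 1 := by
  obtain ⟨l, hl, rfl, h⟩ := P.exists_reduced_word w
  rw [← h]
  simpa using P.length_prod_le (l := s :: l) (by simpa using ⟨hs, hl⟩)

theorem length_le_length_mul {s : P.W} (hs : s ∈ P.S) (w : P.W) :
    P.length w ≤ P.length (s * w) + 1 := by
  have h := P.length_mul_le hs (s * w)
  rwa [← mul_assoc, P.mul_self_of_mem_S hs, one_mul] at h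

theorem length_mul_le_right {s : P.W} (hs : s ∈ P.S) (w : P.W) :
    P.length (w * s) ≤ P.length w + 1 := by
  obtain ⟨l, hl, rfl, h⟩ := P.exists_reduced_word w
  rw [← h]
  have := P.length_prod_le (l := l ++ [s]) (by
    intro x hx
    rcases List.mem_append.1 hx with hx | hx
    · exact hl x hx
    · rw [List.mem_singleton.1 hx]; exact hs)
  simpa using this

theorem exists_eq_mul_left {w : P.W} (hw : w ≠ 1) :
    ∃ s ∈ P.S, ∃ v, w = s * v ∧ P.length v < P.length w := by
  obtain ⟨l, hl, rfl, h⟩ := P.exists_reduced_word w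
  cases l with
  | nil => simp at hw
  | cons s l =>
    refine ⟨s, hl s (by simp), l.prod, by simp, ?_⟩
    rw [← h, List.length_cons]
    exact Nat.lt_succ_of_le (P.length_prod_le fun x hx => hl x (by simp [hx]))

theorem exists_eq_mul_right {w : P.W} (hw : w ≠ 1) :
    ∃ s ∈ P.S, ∃ v, w = v * s ∧ P.length v < P.length w := by
  obtain ⟨l, hl, rfl, h⟩ := P.exists_reduced_word w
  rcases List.eq_nil_or_concat l with rfl | ⟨l, s, rfl⟩
  · simp at hw
  · refine ⟨s, hl s (by simp), l.prod, by simp, ?_⟩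
    rw [← h, List.length_concat]
    exact Nat.lt_succ_of_le (P.length_prod_le fun x hx => hl x (by simp [hx]))

/-! ### Bruhat cells -/

/-- The Bruhat cell `B w B` of an element `w` of the Weyl group. -/
def cell (w : P.W) : Set G :=
  {g | ∃ b ∈ P.B, ∃ n : P.N, (n : P.W) = w ∧ ∃ c ∈ P.B, g = b * n * c}

variable {P} {s v w : P.W} {g h b : G}

theorem coe_mem_cell (n : P.N) : (n : G) ∈ P.cell n :=
  ⟨1, one_mem _, n, rfl, 1, one_mem _, by simp⟩

theorem mul_mem_cell_left (hb : b ∈ P.B) (hg : g ∈ P.cell w) : b * g ∈ P.cell w := by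
  obtain ⟨a, ha, n, hn, c, hc, rfl⟩ := hg
  exact ⟨b * a, mul_mem hb ha, n, hn, c, hc, by group⟩

theorem mul_mem_cell_right (hb : b ∈ P.B) (hg : g ∈ P.cell w) : g * b ∈ P.cell w := by
  obtain ⟨a, ha, n, hn, c, hc, rfl⟩ := hg
  exact ⟨a, ha, n, hn, c * b, mul_mem hc hb, by group⟩

theorem inv_mem_cell (hg : g ∈ P.cell w) : g⁻¹ ∈ P.cell w⁻¹ := by
  obtain ⟨a, ha, n, rfl, c, hc, rfl⟩ := hg
  exact ⟨c⁻¹, inv_mem hc, n⁻¹, rfl, a⁻¹, inv_mem ha, by push_cast; group⟩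

theorem mem_cell_one : g ∈ P.cell 1 ↔ g ∈ P.B := by
  constructor
  · rintro ⟨a, ha, n, hn, c, hc, rfl⟩
    exact mul_mem (mul_mem ha (P.mk_eq_one_iff.1 hn)) hc
  · intro hg
    exact ⟨g, hg, 1, rfl, 1, one_mem _, by simp⟩

theorem exists_eq_of_mem_cell {n : P.N} (hg : g ∈ P.cell n) :
    ∃ b ∈ P.B, ∃ c ∈ P.B, g = b * n * c := by
  obtain ⟨a, ha, m, hm, c, hc, rfl⟩ := hg
  exact ⟨a, ha, (n : G)⁻¹ * m * c, mul_mem (P.mk_eq_mk_iff.1 hm.symm) hc, by group⟩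

theorem exists_mul_eq_of_mem_cell (hg : g ∈ P.cell (v * w)) :
    ∃ x ∈ P.cell v, ∃ y ∈ P.cell w, g = x * y := by
  obtain ⟨a, ha, n, hn, c, hc, rfl⟩ := hg
  obtain ⟨m, rfl⟩ := QuotientGroup.mk_surjective v
  have hw : ((m⁻¹ * n : P.N) : P.W) = w := by
    rw [QuotientGroup.mk_mul, hn, QuotientGroup.mk_inv, inv_mul_cancel_left]
  refine ⟨a * m, mul_mem_cell_left ha (coe_mem_cell m), ((m⁻¹ * n : P.N) : G) * c, ?_, ?_⟩
  · rw [← hw]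
    exact mul_mem_cell_right hc (coe_mem_cell _)
  · push_cast
    group

theorem mem_cell_of_mem_doubleCoset {n : P.N} (hg : g ∈ DoubleCoset.doubleCoset (n : G) P.B P.B) :
    g ∈ P.cell n := by
  obtain ⟨x, hx, y, hy, rfl⟩ := DoubleCoset.mem_doubleCoset.1 hg
  exact ⟨x, hx, n, rfl, y, hy, rfl⟩

theorem mul_mem_cell (hs : s ∈ P.S) (hg : g ∈ P.cell s) (hh : h ∈ P.cell w) :
    g * h ∈ P.cell w ∨ g * h ∈ P.cell (s * w) := by
  obtain ⟨a, ha, n, rfl, c, hc, rfl⟩ := hg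
  obtain ⟨a', ha', m, rfl, c', hc', rfl⟩ := hh
  have e : a * n * c * (a' * m * c') = a * ((n : G) * (c * a') * m * c') := by group
  rw [e]
  refine (P.mul_subset n m hs (c * a') (mul_mem hc ha')).imp (fun h => ?_) fun h => ?_
  · exact mul_mem_cell_left ha (mul_mem_cell_right hc' (mem_cell_of_mem_doubleCoset h))
  · exact mul_mem_cell_left ha
      (mul_mem_cell_right hc' (mem_cell_of_mem_doubleCoset (n := n * m) h))

theorem mul_mem_cell' (hs : s ∈ P.S) (hg : g ∈ P.cell s) (hh : h ∈ P.cell w) :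
    h * g ∈ P.cell w ∨ h * g ∈ P.cell (w * s) := by
  have hg' := inv_mem_cell hg
  rw [P.inv_eq_of_mem_S hs] at hg'
  refine (mul_mem_cell hs hg' (inv_mem_cell hh)).imp (fun h => ?_) fun h => ?_
  · simpa using inv_mem_cell h
  · simpa [P.inv_eq_of_mem_S hs] using inv_mem_cell h

/-- Distinct Bruhat cells are disjoint. -/
theorem eq_of_mem_cell (hv : g ∈ P.cell v) (hw : g ∈ P.cell w) : v = w := by
  wlog hvw : P.length v ≤ P.length w generalizing v w
  · exact (this hw hv (le_of_not_ge hvw)).symm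
  induction hk : P.length v using Nat.strong_induction_on generalizing v w g with
  | _ k ih =>
  subst hk
  by_cases h1 : v = 1
  · subst h1
    obtain ⟨a, ha, n, rfl, c, hc, rfl⟩ := hw
    have h2 := mem_cell_one.1 hv
    rw [mul_mem_cancel_right hc, mul_mem_cancel_left ha] at h2
    exact (P.mk_eq_one_iff.2 h2).symm
  obtain ⟨s, hs, u, rfl, hu⟩ := P.exists_eq_mul_left h1
  obtain ⟨x, hx, y, hy, rfl⟩ := exists_mul_eq_of_mem_cell hv
  have hx' := inv_mem_cell hx
  rw [P.inv_eq_of_mem_S hs] at hx'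
  have key := mul_mem_cell hs hx' hw
  rw [inv_mul_cancel_left] at key
  -- `y` lies in the cell of `u`, so induction gives `u = w`, excluded by length, or `u = s * w`,
  -- that is `s * u = w`.
  rcases key with key | key
  · have := ih _ hu hy key (by lia) rfl
    subst this
    lia
  · have h3 := P.length_le_length_mul hs w
    rw [ih _ hu hy key (by lia) rfl, ← mul_assoc, P.mul_self_of_mem_S hs, one_mul]

/-- Write `w = v * t` with `v` shorter. If `g * h` were in the cell of `w`, cancelling the
`t`-factor would put an element of the cell of `s * v` into that of `v * t` or `v`. Disjointness
then gives `s * v = v * t`, against the lengths, or `s = 1`. -/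
theorem mul_mem_cell_of_length_le (hs : s ∈ P.S) (hl : P.length w ≤ P.length (s * w))
    (hg : g ∈ P.cell s) (hh : h ∈ P.cell w) : g * h ∈ P.cell (s * w) := by
  induction hk : P.length w using Nat.strong_induction_on generalizing w h with
  | _ k ih =>
  subst hk
  by_cases h1 : w = 1
  · subst h1
    rw [mul_one]
    exact mul_mem_cell_right (mem_cell_one.1 hh) hg
  refine (mul_mem_cell hs hg hh).resolve_left fun hw => ?_
  obtain ⟨t, ht, v, rfl, hv⟩ := P.exists_eq_mul_right h1
  obtain ⟨x, hx, y, hy, rfl⟩ := exists_mul_eq_of_mem_cell hh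
  have hy' := inv_mem_cell hy
  rw [P.inv_eq_of_mem_S ht] at hy'
  have h2 := P.length_mul_le_right ht (s * v)
  rw [mul_assoc] at h2
  have hx2 := ih _ hv (by lia) hx rfl
  have key := mul_mem_cell' ht hy' hw
  rw [← mul_assoc, mul_inv_cancel_right, mul_assoc v, P.mul_self_of_mem_S ht, mul_one] at key
  rcases key with key | key
  · have h3 := eq_of_mem_cell key hx2
    rw [h3, ← mul_assoc, P.mul_self_of_mem_S hs, one_mul] at hl
    rw [h3] at hv
    lia
  · have h3 := eq_of_mem_cell key hx2
    exact P.ne_one_of_mem_S hs (by simpa using h3.symm)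

variable (P)

/-- The Bruhat decomposition `G = B N B`. -/
theorem exists_mem_cell (g : G) : ∃ w, g ∈ P.cell w := by
  have hN : ∀ l : List P.W, (∀ x ∈ l, x ∈ P.S) → ∀ n : P.N, (n : P.W) = l.prod →
      ∀ g, (∃ w, g ∈ P.cell w) → ∃ w, n * g ∈ P.cell w := by
    intro l
    induction l with
    | nil =>
      rintro - n hn g ⟨w, hw⟩
      exact ⟨w, mul_mem_cell_left (P.mk_eq_one_iff.1 hn) hw⟩
    | cons s l ih =>
      rintro hl n hn g hg
      have hs := hl s (by simp)
      obtain ⟨m, rfl⟩ := QuotientGroup.mk_surjective s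
      obtain ⟨w, hw⟩ := ih (fun x hx => hl x (by simp [hx])) (m⁻¹ * n) (by
        rw [QuotientGroup.mk_mul, hn, QuotientGroup.mk_inv, List.prod_cons,
          inv_mul_cancel_left]) g hg
      have e : (n : G) * g = m * (((m⁻¹ * n : P.N) : G) * g) := by push_cast; group
      rw [e]
      exact (mul_mem_cell hs (coe_mem_cell m) hw).elim (fun h => ⟨_, h⟩) fun h => ⟨_, h⟩
  have hg : g ∈ Subgroup.closure ((P.B : Set G) ∪ P.N) := by
    rw [← Subgroup.sup_eq_closure, P.sup_eq_top]
    trivial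
  have step : ∀ x ∈ (P.B : Set G) ∪ P.N, ∀ y, (∃ w, y ∈ P.cell w) → ∃ w, x * y ∈ P.cell w := by
    rintro x (hx | hx) y hy
    · exact hy.imp fun w hw => mul_mem_cell_left hx hw
    · obtain ⟨l, hl, h⟩ := P.exists_word ((⟨x, hx⟩ : P.N) : P.W)
      exact hN l hl ⟨x, hx⟩ h.symm y hy
  induction hg using Subgroup.closure_induction_left with
  | one => exact ⟨1, mem_cell_one.2 (one_mem _)⟩
  | mul_left x hx y hy ih => exact step x hx y ih
  | inv_mul_cancel x hx y hy ih =>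
    exact step _ (hx.imp (fun h => inv_mem h) fun h => inv_mem h) y ih

/-! ### Elements conjugating `B` or `U` into `B` -/

variable {P}

/-- Some power `n ^ (k + 1)` lies in `B`, and conjugation by `n⁻¹` is conjugation by `n ^ (-(k +
1))` followed by conjugation by `n ^ k`. -/
theorem inv_conj_mem_of_conj_mem (hP : P.IsSpherical) {n : P.N}
    (hn : ∀ b ∈ P.B, (n : G) * b * (n : G)⁻¹ ∈ P.B) :
    ∀ b ∈ P.B, (n : G)⁻¹ * b * n ∈ P.B := by
  have : Finite P.W := hP
  have hpow : ∀ k : ℕ, ∀ b ∈ P.B, (n : G) ^ k * b * ((n : G) ^ k)⁻¹ ∈ P.B := by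
    intro k
    induction k with
    | zero => simp
    | succ k ih =>
      intro b hb
      have := hn _ (ih b hb)
      rw [pow_succ']
      convert this using 1
      group
  obtain ⟨k, hk⟩ : ∃ k, orderOf (n : P.W) = k + 1 :=
    Nat.exists_eq_succ_of_ne_zero (orderOf_pos (n : P.W)).ne'
  have hT : (n : G) ^ (k + 1) ∈ P.B := by
    have h1 : ((n ^ (k + 1) : P.N) : P.W) = 1 := by
      rw [QuotientGroup.mk_pow, ← hk, pow_orderOf_eq_one]
    simpa using P.mk_eq_one_iff.1 h1
  intro b hb
  have := hpow k _ (mul_mem (mul_mem (inv_mem hT) hb) hT)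
  convert this using 1
  rw [pow_succ]
  group

/-- In a spherical BN-pair, an element of `N` that conjugates `B` into itself lies in `B`. -/
theorem mem_of_conj_mem (hP : P.IsSpherical) {n : P.N}
    (hn : ∀ b ∈ P.B, (n : G) * b * (n : G)⁻¹ ∈ P.B) : (n : G) ∈ P.B := by
  by_contra hnB
  obtain ⟨s, hs, v, hv, hl⟩ := P.exists_eq_mul_left (mt P.mk_eq_one_iff.1 hnB)
  obtain ⟨r, rfl⟩ := QuotientGroup.mk_surjective s
  set m : P.N := r⁻¹ * n with hm
  have hmv : (m : P.W) = v := by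
    rw [hm, QuotientGroup.mk_mul, hv, QuotientGroup.mk_inv, inv_mul_cancel_left]
  have hmG : (m : G) = (r : G)⁻¹ * n := by simp [hm]
  have hn' := inv_conj_mem_of_conj_mem hP hn
  -- Since `r B m ⊆ B n B`, multiplying by `n⁻¹` gives `m⁻¹ B m ⊆ (n⁻¹ B n) B ⊆ B`. As `r = n *
  -- m⁻¹`, it follows that `r B r⁻¹ ⊆ B`, a contradiction.
  have hmB : ∀ b ∈ P.B, ((m⁻¹ : P.N) : G) * b * ((m⁻¹ : P.N) : G)⁻¹ ∈ P.B := by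
    intro b hb
    have h1 : (r : G) * b * m ∈ P.cell n := by
      rw [hv]
      exact mul_mem_cell_of_length_le hs (by rw [← hv]; exact hl.le)
        (mul_mem_cell_right hb (coe_mem_cell r)) (by rw [← hmv]; exact coe_mem_cell m)
    obtain ⟨x, hx, y, hy, h2⟩ := exists_eq_of_mem_cell h1
    have h3 := mul_mem (hn' x hx) hy
    convert h3 using 1
    calc ((m⁻¹ : P.N) : G) * b * ((m⁻¹ : P.N) : G)⁻¹ = (n : G)⁻¹ * (r * b * m) := by
          push_cast
          rw [hmG]
          group
      _ = (n : G)⁻¹ * x * n * y := by rw [h2]; group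
  refine P.conj_not_le r hs fun x hx => ?_
  obtain ⟨b, hb, rfl⟩ := Subgroup.mem_smul_pointwise_iff_exists _ _ _ |>.1 hx
  have h4 := hn _ (hmB b hb)
  convert h4 using 1
  rw [MulAut.smul_def, MulAut.conj_apply]
  push_cast
  rw [hmG]
  group

/-- If `B = U T`, then an element of `G` that conjugates `U` into `B` lies in `B`. -/
theorem mem_of_conj_mem_of_eq_mul (hP : P.IsSpherical) {U : Subgroup G} (hUB : U ≤ P.B)
    (hnorm : (U.subgroupOf P.B).Normal) (hUT : ∀ b ∈ P.B, ∃ u ∈ U, ∃ t ∈ P.T, b = u * t)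
    (hg : ∀ u ∈ U, g * u * g⁻¹ ∈ P.B) : g ∈ P.B := by
  obtain ⟨w, a, ha, n, rfl, c, hc, rfl⟩ := P.exists_mem_cell g
  -- For `g = a * n * c`, the factor `c` normalizes `U` and `n` normalizes `T`, so `n` conjugates
  -- all of `B = U T` into `B`.
  refine mul_mem (mul_mem ha (mem_of_conj_mem hP fun b hb => ?_)) hc
  obtain ⟨u, hu, t, ht, rfl⟩ := hUT b hb
  have h1 : (n : G) * u * (n : G)⁻¹ ∈ P.B := by
    have hcu : c⁻¹ * u * c ∈ U := by
      simpa [Subgroup.mem_subgroupOf] using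
        hnorm.conj_mem ⟨u, hUB hu⟩ hu ⟨c⁻¹, inv_mem hc⟩
    have := mul_mem (mul_mem (inv_mem ha) (hg _ hcu)) ha
    convert this using 1
    group
  have h2 : (n : G) * t * (n : G)⁻¹ ∈ P.B := by
    have := P.normal.conj_mem ⟨t, ht.2⟩ (Subgroup.mem_subgroupOf.2 ht) n
    exact (Subgroup.mem_subgroupOf.1 this).1
  convert mul_mem h1 h2 using 1
  group

theorem building_finite (hP : P.IsSpherical) (hB : P.B.FiniteIndex) : P.building.Finite := by
  have : Finite P.W := hP
  have h : P.building ⊆ ⋃ J : Set P.W,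
      Set.range fun g : G => OrderDual.toDual (g • (P.parabolic J : Set G)) := by
    rintro A ⟨J, -, g, rfl⟩
    exact Set.mem_iUnion.2 ⟨J, g, rfl⟩
  refine (Set.finite_iUnion fun J => ?_).subset h
  have : (P.parabolic J).FiniteIndex := Subgroup.finiteIndex_of_le (H := P.B) le_sup_left
  let f : G ⧸ P.parabolic J → (Set G)ᵒᵈ := Quotient.lift
    (fun g : G => OrderDual.toDual (g • (P.parabolic J : Set G))) fun a b hab => by
      congr 1
      exact (leftCoset_eq_iff _).2 (QuotientGroup.leftRel_apply.1 hab)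
  refine (Set.finite_range f).subset ?_
  rintro _ ⟨g, rfl⟩
  exact ⟨(g : G ⧸ P.parabolic J), rfl⟩

/-! ### `B` is closed and open -/

section Topology

variable [TopologicalSpace G] [IsTopologicalGroup G]

/-- In a Hausdorff group, the Borel subgroup of a split spherical BN-pair is closed. -/
theorem isClosed_B [T2Space G] (hP : P.IsSpherical) (hsplit : P.IsSplit) :
    IsClosed (P.B : Set G) := by
  obtain ⟨-, U, hUB, hnorm, hnil, hcompl⟩ := hsplit
  have hUT : ∀ b ∈ P.B, ∃ u ∈ U, ∃ t ∈ P.T, b = u * t := by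
    intro b hb
    obtain ⟨⟨u, t⟩, h⟩ := hcompl.surjective ⟨b, hb⟩
    exact ⟨_, u.2, _, t.2, congrArg Subtype.val h.symm⟩
  have hmem : ∀ g : G, (∀ u ∈ U, g * u * g⁻¹ ∈ P.B) → g ∈ P.B := fun g hg =>
    mem_of_conj_mem_of_eq_mul hP hUB hnorm hUT hg
  obtain ⟨k, hk⟩ := (Subgroup.isNilpotent_iff_lowerCentralSeries U).1 hnil
  -- The index `i` climbs from the trivial term, closed because `G` is Hausdorff, up to `U` itself.
  have hlcs : ∀ i ≤ k, closure (U.lowerCentralSeries (k - i) : Set G) ⊆ P.B := by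
    intro i
    induction i with
    | zero =>
      rintro -
      rw [Nat.sub_zero, hk, Subgroup.coe_bot, closure_singleton]
      exact Set.singleton_subset_iff.2 (one_mem _)
    | succ i ih =>
      intro hi x hx
      -- By continuity, commutators with `u` fall into the closure of the next term, already inside
      -- `B`; hence `x * u * x⁻¹ ∈ B`.
      have hmaps : ∀ u ∈ U, x * u * x⁻¹ * u⁻¹ ∈ closure (U.lowerCentralSeries (k - i) : Set G) := by
        intro u hu
        refine map_mem_closure (f := fun y => y * u * y⁻¹ * u⁻¹) (by fun_prop) hx fun y hy => ?_
        rw [show k - i = k - (i + 1) + 1 by lia]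
        exact Subgroup.commutator_mem_commutator hy hu
      refine hmem x fun u hu => ?_
      have := mul_mem (ih (by lia) (hmaps u hu)) (hUB hu)
      simpa using this
  have hU : closure (U : Set G) ⊆ P.B := by simpa using hlcs k le_rfl
  refine isClosed_of_closure_subset fun x hx => hmem x fun u hu => hU ?_
  refine map_mem_closure (f := fun y => y * u * y⁻¹) (by fun_prop) hx fun y hy => ?_
  simpa [Subgroup.mem_subgroupOf] using hnorm.conj_mem ⟨u, hUB hu⟩ hu ⟨y, hy⟩

theorem isCompact_cell (hB : IsCompact (P.B : Set G)) (w : P.W) : IsCompact (P.cell w) := by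
  obtain ⟨n, rfl⟩ := QuotientGroup.mk_surjective w
  have : P.cell n = (P.B : Set G) * {(n : G)} * P.B := by
    ext g
    constructor
    · intro hg
      obtain ⟨b, hb, c, hc, rfl⟩ := exists_eq_of_mem_cell hg
      exact Set.mul_mem_mul (Set.mul_mem_mul hb rfl) hc
    · exact fun hg => mem_cell_of_mem_doubleCoset hg
  rw [this]
  exact (hB.mul isCompact_singleton).mul hB

/-- If `B` is compact and the BN-pair is spherical, then `B` is open: its complement is the union
of the other Bruhat cells, which are finite in number and compact. -/
theorem isOpen_B [T2Space G] (hP : P.IsSpherical) (hB : IsCompact (P.B : Set G)) :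
    IsOpen (P.B : Set G) := by
  have : Finite P.W := hP
  have h : (P.B : Set G)ᶜ = ⋃ w : {w : P.W // w ≠ 1}, P.cell w := by
    ext g
    simp only [Set.mem_compl_iff, SetLike.mem_coe, Set.mem_iUnion]
    constructor
    · intro hg
      obtain ⟨w, hw⟩ := P.exists_mem_cell g
      exact ⟨⟨w, by rintro rfl; exact hg (mem_cell_one.1 hw)⟩, hw⟩
    · rintro ⟨⟨w, hw1⟩, hw⟩ hg
      exact hw1 (eq_of_mem_cell hw (mem_cell_one.2 hg))
  rw [← isClosed_compl_iff, h]
  exact isClosed_iUnion_of_finite fun w => (isCompact_cell hB _).isClosed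

end Topology

end BNPair

theorem theorem2 {G : Type*} [Group G] [TopologicalSpace G] [IsTopologicalGroup G]
    [CompactSpace G] [T2Space G] (P : BNPair G) (hspherical : P.IsSpherical)
    (hsplit : P.IsSplit) :
    P.building.Finite ∧ P.B.FiniteIndex := by
  have hopen := BNPair.isOpen_B hspherical (BNPair.isClosed_B hspherical hsplit).isCompact
  have : Finite (G ⧸ P.B) := P.B.quotient_finite_of_isOpen hopen
  have hB : P.B.FiniteIndex := Subgroup.finiteIndex_of_finite_quotient
  exact ⟨BNPair.building_finite hspherical hB, hB⟩
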